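/- Let $X$ be a finite set and let $S:X\times X\to X\times X$, $S(x,y)=(g_x(y),f_y(x))$, be a non-degenerate symmetric set-theoretical solution of the Yang–Baxter equation: all maps $g_x,f_x:X\to X$ are bijective, $S\circ S=\mathrm{Id}$, and $S^{12}S^{23}S^{12}=S^{23}S^{12}S^{23}$ on $X^3$. Let $M=M(X,S)$ and $G=G(X,S)$ be the monoid and the group with presentation $\langle X\mid xy=g_x(y)f_y(x);\ x,y\in X,\ S(x,y)\neq(x,y)\rangle$. Since the relations are homogeneous, every $a\in M$ has a length $\ell_X(a)$, the length of any word on $X$ representing it. An element $f$ is a left (resp. right) divisor of $g$ in $M$ if $g=fh$ (resp. $g=hf$) for some $h\in M$. A Garside element of $M$ is an element whose sets of left and right divisors coincide and whose divisors generate $M$. Let $V$ be a real vector space with basis $X$. Let $\phi:G\to\mathfrak S(X)$, $a\mapsto\phi_a$, be the morphism with $\phi_x=f_x^{-1}$ for $x\in X$, and let $\psi:G\to GL(V)$, $a\mapsto\psi_a$, be the morphism with $\psi_x(y)=\phi_x(y)$ for $y\in X$, $y\ne x$, and $\psi_x(x)=-\phi_x(x)$; for $a\in M$, the maps $\phi_a,\psi_a$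 are those of the image of $a$ in $G$. Let $W=\psi(G)$ and $\mathbf X=\{\psi_x\mid x\in X\}$, a finite group and a subset generating it as a monoid. Let $\ell_{\mathbf X}(w)$ be the minimal length of a word on $\mathbf X$ representing $w\in W$, and for $\rho\in GL(V)$ let $n(\rho)=\#\{x\in X\mid\rho(x)\notin X\}$. If $w=vv'$ in $W$ with $\ell_{\mathbf X}(w)=\ell_{\mathbf X}(v)+\ell_{\mathbf X}(v')$, then $v$ is called a left $\mathbf X$-factor and $v'$ a right $\mathbf X$-factor of $w$; the element $w$ is $\mathbf X$-balanced if its sets of left and right $\mathbf X$-factors coincide. Then $M$ has exactly one Garside element $\Delta$ that divides every Garside element on the left and on the right. Let $\mathrm{Div}(\Delta)$ be its set of divisors. (1) For every $a\in\mathrm{Div}(\Delta)$, $\ell_X(a)=\ell_{\mathbf X}(\psi_a)=n(\psi_a)$. Moreover, for every $x\in X$, $\psi_a(x)=-\phi_a(x)$ if $x$ right divides $a$ in $M$, and $\psi_a(x)=\phi_a(x)$ otherwise. (2) The restriction of $a\mapsto\psi_a$ to $\mathrm{Div}(\Delta)$ is injective. (3) The element $\psi_\Delta$ is $\mathbf X$-balanced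 in $W$, and its set of $\mathbf X$-factors is $\{\psi_a\mid a\in\mathrm{Div}(\Delta)\}$. -/

import Mathlib

noncomputable section

/-- The length of an element `w` of a monoid with respect to a set `A`: the minimal length of
a word on `A` that represents `w`. -/
def wordLength {W : Type*} [Monoid W] (A : Set W) (w : W) : ℕ :=
  sInf {k : ℕ | ∃ l : List W, (∀ v ∈ l, v ∈ A) ∧ l.prod = w ∧ l.length = k}

/-- The left `A`-factors of `w`: those `v` with `w = v * u` and `ℓ(w) = ℓ(v) + ℓ(u)`. -/
def leftFactors {W : Type*} [Monoid W] (A : Set W) (w : W) : Set W :=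
  {v | ∃ u, w = v * u ∧ wordLength A w = wordLength A v + wordLength A u}

/-- The right `A`-factors of `w`: those `v` with `w = u * v` and `ℓ(w) = ℓ(u) + ℓ(v)`. -/
def rightFactors {W : Type*} [Monoid W] (A : Set W) (w : W) : Set W :=
  {v | ∃ u, w = u * v ∧ wordLength A w = wordLength A u + wordLength A v}

/-- `w` is `A`-balanced: its left `A`-factors and its right `A`-factors coincide. -/
def IsFactorBalanced {W : Type*} [Monoid W] (A : Set W) (w : W) : Prop :=
  leftFactors A w = rightFactors A w

/-- `f` is a left divisor of `g`. -/
def LeftDivides {M : Type*} [Monoid M] (f g : M) : Prop := ∃ h, g = f * h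

/-- `f` is a right divisor of `g`. -/
def RightDivides {M : Type*} [Monoid M] (f g : M) : Prop := ∃ h, g = h * f

/-- `d` has the same left and right divisors. -/
def IsBalanced {M : Type*} [Monoid M] (d : M) : Prop :=
  ∀ a, LeftDivides a d ↔ RightDivides a d

/-- The set of divisors of a balanced element. -/
def divisorSet {M : Type*} [Monoid M] (d : M) : Set M := {a | LeftDivides a d}

/-- A Garside element: a balanced element whose divisors generate the monoid. -/
def IsGarsideElement {M : Type*} [Monoid M] (d : M) : Prop :=
  IsBalanced d ∧ Submonoid.closure (divisorSet d) = ⊤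

/-- `d` is the minimal Garside element, for both left and right divisibility. -/
def IsMinGarsideElement {M : Type*} [Monoid M] (d : M) : Prop :=
  IsGarsideElement d ∧ ∀ e, IsGarsideElement e → LeftDivides d e ∧ RightDivides d e

/-- `S` acting on the first two components. -/
def act12 {X : Type*} (S : X × X → X × X) : X × X × X → X × X × X :=
  fun p => ((S (p.1, p.2.1)).1, (S (p.1, p.2.1)).2, p.2.2)

/-- `S` acting on the last two components. -/
def act23 {X : Type*} (S : X × X → X × X) : X × X × X → X × X × X :=
  fun p => (p.1, S p.2)

/-- A non-degenerate symmetric (that is, involutive and braided) set-theoretical solution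
`(X, S)` of the Yang-Baxter equation. Here `S (x, y) = (g x y, f y x)`. -/
structure YBSolution (X : Type*) where
  S : X × X → X × X
  bijective_g : ∀ x, Function.Bijective fun y => (S (x, y)).1
  bijective_f : ∀ y, Function.Bijective fun x => (S (x, y)).2
  involutive : ∀ p, S (S p) = p
  braided : act12 S ∘ act23 S ∘ act12 S = act23 S ∘ act12 S ∘ act23 S

namespace YBSolution

variable {X : Type*} (sol : YBSolution X)

/-- `S (x, y) = (g x y, f y x)`. -/
def g (x y : X) : X := (sol.S (x, y)).1

/-- `S (x, y) = (g x y, f y x)`. -/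
def f (y x : X) : X := (sol.S (x, y)).2

/-- The defining relations `x y = g_x(y) f_y(x)`, for `S (x, y) ≠ (x, y)`, between words. -/
def monoidRels (v w : FreeMonoid X) : Prop :=
  ∃ x y : X, sol.S (x, y) ≠ (x, y) ∧
    v = FreeMonoid.of x * FreeMonoid.of y ∧
    w = FreeMonoid.of (sol.g x y) * FreeMonoid.of (sol.f y x)

/-- The same relations, as relators of a group presentation. -/
def groupRels : Set (FreeGroup X) :=
  {r | ∃ x y : X, sol.S (x, y) ≠ (x, y) ∧
    r = FreeGroup.of x * FreeGroup.of y *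
      (FreeGroup.of (sol.g x y) * FreeGroup.of (sol.f y x))⁻¹}

/-- The monoid `M(X,S)`. -/
abbrev M : Type _ := PresentedMonoid sol.monoidRels

/-- The structure group `G(X,S)`. -/
abbrev G : Type _ := PresentedGroup sol.groupRels

/-- The element of `M(X,S)` given by an element of `X`. -/
def gen (x : X) : sol.M := PresentedMonoid.of sol.monoidRels x

theorem toG_aux (v w : FreeMonoid X) (h : sol.monoidRels v w) :
    FreeMonoid.lift (fun x => (PresentedGroup.of x : sol.G)) v =
      FreeMonoid.lift (fun x => (PresentedGroup.of x : sol.G)) w := by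
  obtain ⟨x, y, hxy, rfl, rfl⟩ := h
  simp only [map_mul, FreeMonoid.lift_eval_of]
  exact PresentedGroup.mk_eq_mk_of_mul_inv_mem ⟨x, y, hxy, rfl⟩

/-- The canonical morphism `M(X,S) → G(X,S)`, through which `φ` and `ψ` are evaluated on
elements of `M(X,S)`. -/
def toG : sol.M →* sol.G :=
  PresentedMonoid.lift (fun x => (PresentedGroup.of x : sol.G)) sol.toG_aux

theorem lengthHom_aux (v w : FreeMonoid X) (h : sol.monoidRels v w) :
    FreeMonoid.lift (fun _ : X => Multiplicative.ofAdd (1 : ℕ)) v =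
      FreeMonoid.lift (fun _ : X => Multiplicative.ofAdd (1 : ℕ)) w := by
  obtain ⟨x, y, hxy, rfl, rfl⟩ := h
  simp

/-- The length function as a morphism: every generator has length one. -/
def lengthHom : sol.M →* Multiplicative ℕ :=
  PresentedMonoid.lift (fun _ : X => Multiplicative.ofAdd (1 : ℕ)) sol.lengthHom_aux

/-- The length of an element of `M(X,S)`. -/
def len (a : sol.M) : ℕ := Multiplicative.toAdd (sol.lengthHom a)

/-- The length of an element is the length of any of its word representatives. -/
theorem len_mk (w : FreeMonoid X) :
    sol.len (PresentedMonoid.mk sol.monoidRels w) = w.toList.length := by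
  induction w with
  | one => simp [len]
  | of x => rfl
  | mul x y hx hy =>
    simp only [len, map_mul, toAdd_mul, FreeMonoid.toList_mul, List.length_append] at *
    omega

/-- `φ_x = f_x⁻¹`. -/
def phiGen (x : X) : Equiv.Perm X := (Equiv.ofBijective (sol.f x) (sol.bijective_f x)).symm

theorem phiGen_f (x y : X) : sol.phiGen x (sol.f x y) = y :=
  (Equiv.ofBijective (sol.f x) (sol.bijective_f x)).symm_apply_apply y

theorem f_phiGen (x y : X) : sol.f x (sol.phiGen x y) = y :=
  (Equiv.ofBijective (sol.f x) (sol.bijective_f x)).apply_symm_apply y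

theorem f_f (a x y : X) :
    sol.f y (sol.f x a) = sol.f (sol.f y x) (sol.f (sol.g x y) a) :=
  congrArg (fun p => p.2.2) (congrFun sol.braided (a, x, y))

theorem f_g (x y : X) : sol.f (sol.f y x) (sol.g x y) = y :=
  congrArg Prod.snd (sol.involutive (x, y))

theorem phiGen_mul (x y : X) :
    sol.phiGen x * sol.phiGen y = sol.phiGen (sol.g x y) * sol.phiGen (sol.f y x) := by
  have h : ∀ z, sol.f y (sol.f x ((sol.phiGen (sol.g x y) * sol.phiGen (sol.f y x)) z)) = z := by
    intro z
    rw [f_f, Equiv.Perm.mul_apply, f_phiGen, f_phiGen]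
  ext z
  have := h z
  conv_lhs => rw [← this]
  rw [Equiv.Perm.mul_apply, phiGen_f, phiGen_f]

theorem phi_aux (r : FreeGroup X) (h : r ∈ sol.groupRels) :
    FreeGroup.lift sol.phiGen r = 1 := by
  obtain ⟨x, y, -, rfl⟩ := h
  simp only [map_mul, map_inv, FreeGroup.lift_apply_of]
  rw [phiGen_mul, mul_inv_rev, mul_assoc, mul_inv_cancel_left, mul_inv_cancel]

/-- The morphism `φ` from `G(X,S)` to the symmetric group on `X`. -/
def phi : sol.G →* Equiv.Perm X := PresentedGroup.toGroup (f := sol.phiGen) sol.phi_aux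

section Representation

/-! `V` is a real vector space with basis (indexed by) `X`; the group `V ≃ₗ[ℝ] V` is `GL(V)`. -/

variable {V : Type*} [AddCommGroup V] [Module ℝ V] (b : Module.Basis X ℝ V)

open Classical in
/-- The linear automorphism `ψ_x`, with `ψ_x(y) = φ_x(y)` for `y ≠ x` and `ψ_x(x) = -φ_x(x)`. -/
def psiGen (x : X) : V ≃ₗ[ℝ] V :=
  b.equiv ((b.reindex (sol.phiGen x).symm).unitsSMul (fun y => if y = x then -1 else 1))
    (Equiv.refl X)

theorem psiGen_of_ne {x y : X} (h : y ≠ x) : sol.psiGen b x (b y) = b (sol.phiGen x y) := by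
  simp [psiGen, Module.Basis.unitsSMul_apply, h]

theorem psiGen_self (x : X) : sol.psiGen b x (b x) = -b (sol.phiGen x x) := by
  simp [psiGen, Module.Basis.unitsSMul_apply]

theorem psiGen_mul {x y : X} (hxy : sol.S (x, y) ≠ (x, y)) :
    sol.psiGen b x * sol.psiGen b y =
      sol.psiGen b (sol.g x y) * sol.psiGen b (sol.f y x) := by
  have hphi : ∀ z, sol.phiGen x (sol.phiGen y z) =
      sol.phiGen (sol.g x y) (sol.phiGen (sol.f y x) z) :=
    fun z => Equiv.congr_fun (sol.phiGen_mul x y) z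
  have hne : y ≠ sol.f y x := by
    intro h
    apply hxy
    have h1 : sol.f y (sol.g x y) = sol.f y x := by
      have := sol.f_g x y
      rw [← h] at this
      rw [this]; exact h
    have h2 : sol.g x y = x := (sol.bijective_f y).1 h1
    exact Prod.ext h2 h.symm
  have key1 : ∀ z, sol.phiGen y z = x ↔ z = sol.f y x := fun z =>
    ⟨fun h => by rw [← h, f_phiGen], fun h => by rw [h, phiGen_f]⟩
  have key2 : ∀ z, sol.phiGen (sol.f y x) z = sol.g x y ↔ z = y := fun z =>
    ⟨fun h => by rw [← sol.f_g x y, ← h, f_phiGen],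
      fun h => by
        have := sol.phiGen_f (sol.f y x) (sol.g x y)
        rw [f_g] at this
        rw [h, this]⟩
  apply LinearEquiv.toLinearMap_injective
  apply b.ext
  intro z
  change sol.psiGen b x (sol.psiGen b y (b z)) =
    sol.psiGen b (sol.g x y) (sol.psiGen b (sol.f y x) (b z))
  by_cases h1 : z = y
  · subst h1
    have h2 : sol.phiGen z z ≠ x := fun h => hne ((key1 z).1 h)
    rw [psiGen_self, map_neg, psiGen_of_ne _ _ h2, psiGen_of_ne _ _ hne, (key2 z).2 rfl,
      psiGen_self, hphi, (key2 z).2 rfl]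
  · have h3 : sol.phiGen (sol.f y x) z ≠ sol.g x y := fun h => h1 ((key2 z).1 h)
    rw [psiGen_of_ne _ _ h1]
    by_cases h2 : z = sol.f y x
    · rw [(key1 z).2 h2, psiGen_self]
      rw [h2] at h3
      rw [h2, psiGen_self, map_neg, psiGen_of_ne _ _ h3, ← hphi, phiGen_f]
    · rw [psiGen_of_ne _ _ (fun h => h2 ((key1 z).1 h)), psiGen_of_ne _ _ h2,
        psiGen_of_ne _ _ h3, hphi]

theorem psi_aux (r : FreeGroup X) (h : r ∈ sol.groupRels) :
    FreeGroup.lift (sol.psiGen b) r = 1 := by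
  obtain ⟨x, y, hxy, rfl⟩ := h
  simp only [map_mul, map_inv, FreeGroup.lift_apply_of]
  rw [sol.psiGen_mul b hxy, mul_inv_rev, mul_assoc, mul_inv_cancel_left, mul_inv_cancel]

/-- The linear representation `ψ` of `G(X,S)` on `V`. -/
def psi : sol.G →* (V ≃ₗ[ℝ] V) := PresentedGroup.toGroup (f := sol.psiGen b) (sol.psi_aux b)

/-- The group `W(X,S) = ψ(G(X,S))`. -/
abbrev W : Subgroup (V ≃ₗ[ℝ] V) := (sol.psi b).range

/-- For `a` in `M(X,S)`, the permutation `φ_a`. -/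
def phiM (a : sol.M) : Equiv.Perm X := sol.phi (sol.toG a)

/-- For `a` in `M(X,S)`, the element `ψ_a` of `W(X,S)`. -/
def psiM (a : sol.M) : sol.W b := (sol.psi b).rangeRestrict (sol.toG a)

/-- The generating set `{ψ_x | x ∈ X}` of `W(X,S)`. -/
def genSet : Set (sol.W b) := Set.range fun x => sol.psiM b (sol.gen x)

/-- `ψ_a(x) = ± φ_a(x)`. -/
theorem psi_apply (a : sol.G) (y : X) :
    sol.psi b a (b y) = b (sol.phi a y) ∨ sol.psi b a (b y) = -b (sol.phi a y) := by
  have hof : ∀ x : X, sol.psi b (PresentedGroup.of x) = sol.psiGen b x :=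
    fun x => PresentedGroup.toGroup.of _
  have hof' : ∀ x : X, sol.phi (PresentedGroup.of x) = sol.phiGen x :=
    fun x => PresentedGroup.toGroup.of _
  have hinv : ∀ a : sol.G,
      (∀ y, sol.psi b a (b y) = b (sol.phi a y) ∨ sol.psi b a (b y) = -b (sol.phi a y)) →
      ∀ y, sol.psi b a⁻¹ (b y) = b (sol.phi a⁻¹ y) ∨
        sol.psi b a⁻¹ (b y) = -b (sol.phi a⁻¹ y) := by
    intro a ha y
    have hc : ∀ v, sol.psi b a⁻¹ (sol.psi b a v) = v := by
      intro v
      rw [← LinearEquiv.mul_apply, ← map_mul, inv_mul_cancel, map_one, LinearEquiv.coe_one, id]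
    have hy : sol.phi a (sol.phi a⁻¹ y) = y := by
      rw [← Equiv.Perm.mul_apply, ← map_mul, mul_inv_cancel, map_one, Equiv.Perm.one_apply]
    rcases ha (sol.phi a⁻¹ y) with h | h
    · left
      have := hc (b (sol.phi a⁻¹ y))
      rwa [h, hy] at this
    · right
      have := hc (b (sol.phi a⁻¹ y))
      rw [h, hy, map_neg] at this
      rw [← this, neg_neg]
  have hx : ∀ x y : X, sol.psi b (PresentedGroup.of x) (b y) =
      b (sol.phi (PresentedGroup.of x) y) ∨
      sol.psi b (PresentedGroup.of x) (b y) = -b (sol.phi (PresentedGroup.of x) y) := by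
    intro x y
    rw [hof, hof']
    by_cases h : y = x
    · subst h
      exact Or.inr (sol.psiGen_self b y)
    · exact Or.inl (sol.psiGen_of_ne b h)
  revert y
  induction a using PresentedGroup.induction_on with | _ z
  induction z using FreeGroup.induction_on with
  | C1 => intro y; left; simp
  | of x => exact hx x
  | inv_of x h => exact hinv _ h
  | mul u v hu hv =>
    intro y
    rw [map_mul, map_mul, map_mul, LinearEquiv.mul_apply, Equiv.Perm.mul_apply]
    rcases hv y with h | h <;> rcases hu (sol.phi (PresentedGroup.mk _ v) y) with h' | h' <;>
      simp [h, h']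

/-- `W(X,S)` is a finite group. -/
theorem finite_W [Finite X] : Finite (sol.W b) := by
  have hE : (Set.range b ∪ Set.range fun y => -b y).Finite :=
    (Set.finite_range _).union (Set.finite_range _)
  have : Finite ↑(Set.range b ∪ Set.range fun y => -b y) := hE
  have hmem : ∀ (w : sol.W b) (y : X),
      (w : V ≃ₗ[ℝ] V) (b y) ∈ Set.range b ∪ Set.range fun y => -b y := by
    rintro ⟨_, a, rfl⟩ y
    rcases sol.psi_apply b a y with h | h
    · exact Or.inl ⟨_, h.symm⟩
    · exact Or.inr ⟨_, h.symm⟩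
  refine Finite.of_injective (β := X → ↑(Set.range b ∪ Set.range fun y => -b y))
    (fun w y => ⟨_, hmem w y⟩) ?_
  intro w w' h
  apply Subtype.ext
  apply LinearEquiv.toLinearMap_injective
  apply b.ext
  intro y
  exact congrArg Subtype.val (congrFun h y)

/-- The set `{ψ_x | x ∈ X}` generates `W(X,S)` as a monoid, so that every element of `W(X,S)` is
represented by a word on it. -/
theorem closure_genSet [Finite X] : Submonoid.closure (sol.genSet b) = ⊤ := by
  have := sol.finite_W b
  rw [← Subgroup.closure_toSubmonoid_of_finite]
  have h : sol.genSet b =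
      (sol.psi b).rangeRestrict '' Set.range (PresentedGroup.of (rels := sol.groupRels)) := by
    rw [← Set.range_comp]
    rfl
  have h2 : Subgroup.closure (sol.genSet b) = ⊤ := by
    rw [h, ← MonoidHom.map_closure, PresentedGroup.closure_range_of, ← MonoidHom.range_eq_map,
      MonoidHom.range_eq_top]
    exact (sol.psi b).rangeRestrict_surjective
  rw [h2]
  rfl

end Representation

end YBSolution

/-- `n(ρ)` is the number of elements `x` of the basis `X` with `ρ(x) ∉ X`. -/
def signCount {X V : Type*} [AddCommGroup V] [Module ℝ V] (b : Module.Basis X ℝ V)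
    (ρ : V ≃ₗ[ℝ] V) : ℕ :=
  Set.ncard {x : X | ρ (b x) ∉ Set.range b}

end

/-!
The map `a ↦ c_a` sending a generator `x` to the basis vector `x` of `ℕ^X` extends to `M` by the
cocycle rule `c_{ab}(z) = c_b(z) + c_a(φ_b(z))`. Any two generators `x`, `y` have the common left
multiple `φ_x(y) x = φ_y(x) y`, whence `x` divides `a` on the right as soon as `c_a(x) > 0`. It
follows that `c` is a bijection from `M` onto `ℕ^X` that turns right divisibility into the
pointwise order. In this picture the Garside element `Δ` is the constant function `1`, and its
divisors are the elements `a` with `c_a ≤ 1`.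

The sign of `ψ_a(x)` is `(-1)^{c_a(x)}`. If `c_s ≤ 1`, then every `a` with `ψ_a = ψ_s` satisfies
`c_s ≤ c_a` by parity, so it is a left multiple of `s`: the length of `s` cannot drop in `W`,
factorizations of `ψ_s` lift to `M`, and `s` is determined by `ψ_s`.
-/

theorem IsBalanced.of_finite_rightDivides {M : Type*} [Monoid M] [IsLeftCancelMul M] {d : M}
    (hfin : {a | RightDivides a d}.Finite) (hdiv : ∀ a, LeftDivides a d → RightDivides a d) :
    IsBalanced d := by
  refine fun a => ⟨hdiv a, fun ha => ?_⟩
  have : Finite {a | RightDivides a d} := hfin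
  have hcompl : ∀ u : {a | RightDivides a d}, ∃ v : {a | RightDivides a d}, d = v * u :=
    fun ⟨u, v, hv⟩ => ⟨⟨v, hdiv v ⟨u, hv⟩⟩, hv⟩
  choose compl hd using hcompl
  have hinj : Function.Injective compl := fun u u' h =>
    Subtype.ext (mul_left_cancel (a := (compl u : M)) (by rw [← hd u, h, ← hd u']))
  obtain ⟨u, hu⟩ := Finite.surjective_of_injective hinj ⟨a, ha⟩
  exact ⟨u, by simpa only [hu] using hd u⟩

theorem basis_ne_neg_basis {R V ι : Type*} [Ring R] [NeZero (2 : R)] [AddCommGroup V]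
    [Module R V] (b : Module.Basis ι R V) (i j : ι) : b i ≠ -b j := by
  intro h
  have hsum : (1 : R) = -1 := by
    simpa only [map_neg, b.sumCoords_self_apply] using congrArg b.sumCoords h
  exact two_ne_zero (α := R) (by rw [← one_add_one_eq_two, add_eq_zero_iff_eq_neg, ← hsum])

namespace YBSolution

variable {X : Type*} (sol : YBSolution X)

/-! ### Generators and length -/

@[elab_as_elim]
theorem mul_gen_induction {p : sol.M → Prop} (one : p 1)
    (mul_gen : ∀ a x, p a → p (a * sol.gen x)) (a : sol.M) : p a := by
  have ha : a ∈ Submonoid.closure (Set.range sol.gen) :=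
    (PresentedMonoid.closure_range_of sol.monoidRels).symm ▸ Submonoid.mem_top a
  induction ha using Submonoid.closure_induction_right with
  | one => exact one
  | mul_right a _ x hx ih =>
    obtain ⟨x, rfl⟩ := hx
    exact mul_gen a x ih

theorem gen_mul_gen (x y : X) :
    sol.gen x * sol.gen y = sol.gen (sol.g x y) * sol.gen (sol.f y x) := by
  by_cases hxy : sol.S (x, y) = (x, y)
  · rw [show sol.g x y = x from congrArg Prod.fst hxy,
      show sol.f y x = y from congrArg Prod.snd hxy]
  · exact PresentedMonoid.mk_eq_mk_of_rel ⟨x, y, hxy, rfl, rfl⟩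

theorem g_phiGen (x y : X) : sol.g (sol.phiGen x y) x = sol.phiGen y x := by
  apply (sol.bijective_f y).1
  change sol.f y _ = sol.f y _
  have h := sol.f_g (sol.phiGen x y) x
  rwa [f_phiGen] at h ⊢

theorem gen_phiGen_mul_gen (x y : X) :
    sol.gen (sol.phiGen x y) * sol.gen x = sol.gen (sol.phiGen y x) * sol.gen y := by
  rw [gen_mul_gen, f_phiGen, g_phiGen]

theorem len_one : sol.len 1 = 0 := rfl

theorem len_gen (x : X) : sol.len (sol.gen x) = 1 := rfl

theorem len_mul (a d : sol.M) : sol.len (a * d) = sol.len a + sol.len d := by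
  simp [len]

theorem len_eq_zero_iff {a : sol.M} : sol.len a = 0 ↔ a = 1 := by
  refine ⟨fun ha => ?_, fun ha => ha ▸ sol.len_one⟩
  induction a using sol.mul_gen_induction with
  | one => rfl
  | mul_gen a x => simp [len_mul, len_gen] at ha

theorem mem_of_mem_closure_of_len_eq_one {D : Set sol.M} {a : sol.M}
    (ha : a ∈ Submonoid.closure D) (hlen : sol.len a = 1) : a ∈ D := by
  induction ha using Submonoid.closure_induction with
  | mem a ha => exact ha
  | one => simp [len_one] at hlen
  | mul a d _ _ iha ihd =>
    rw [len_mul, Nat.add_eq_one_iff] at hlen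
    rcases hlen with ⟨ha, hd⟩ | ⟨ha, hd⟩
    · rw [sol.len_eq_zero_iff.1 ha, one_mul]
      exact ihd hd
    · rw [sol.len_eq_zero_iff.1 hd, mul_one]
      exact iha ha

variable {sol} in
theorem len_le_of_rightDivides {a d : sol.M} (h : RightDivides a d) : sol.len a ≤ sol.len d := by
  obtain ⟨c, rfl⟩ := h
  exact sol.len_mul c a ▸ Nat.le_add_left _ _

variable {sol} in
theorem eq_of_rightDivides_of_len_le {a d : sol.M} (h : RightDivides a d)
    (hlen : sol.len d ≤ sol.len a) : a = d := by
  obtain ⟨c, rfl⟩ := h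
  have hc : sol.len c = 0 := by
    rw [len_mul] at hlen
    omega
  rw [sol.len_eq_zero_iff.1 hc, one_mul]

/-! ### The cocycle -/

theorem phiM_one : sol.phiM 1 = 1 := by simp [phiM]

theorem phiM_mul (a d : sol.M) : sol.phiM (a * d) = sol.phiM a * sol.phiM d := by simp [phiM]

theorem phiM_gen (x : X) : sol.phiM (sol.gen x) = sol.phiGen x :=
  PresentedGroup.toGroup.of sol.phi_aux

/-- The affine transformation `u ↦ x + u ∘ φ_x` of `ℕ^X`, by which the generator `x` acts on the
right. Functions are finitely supported so that `X` may be infinite, and `u ∘ φ_x` is written as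
the push-forward of `u` along `f_x = φ_x⁻¹`. -/
noncomputable def affineStep (x : X) : Function.End (X →₀ ℕ) :=
  fun u => Finsupp.single x 1 + u.mapDomain (sol.f x)

theorem affineStep_affineStep (x y : X) (u : X →₀ ℕ) :
    sol.affineStep y (sol.affineStep x u) =
      sol.affineStep (sol.f y x) (sol.affineStep (sol.g x y) u) := by
  have hf : sol.f y ∘ sol.f x = sol.f (sol.f y x) ∘ sol.f (sol.g x y) :=
    funext fun z => sol.f_f z x y
  simp only [affineStep, Finsupp.mapDomain_add, Finsupp.mapDomain_single,
    ← Finsupp.mapDomain_comp, hf, f_g]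
  exact add_left_comm _ _ _

theorem affineStep_rel (v w : FreeMonoid X) (h : sol.monoidRels v w) :
    FreeMonoid.lift (fun x => MulOpposite.op (sol.affineStep x)) v =
      FreeMonoid.lift (fun x => MulOpposite.op (sol.affineStep x)) w := by
  obtain ⟨x, y, -, rfl, rfl⟩ := h
  simp only [map_mul, FreeMonoid.lift_eval_of, ← MulOpposite.op_mul]
  exact congrArg MulOpposite.op (funext (sol.affineStep_affineStep x y))

/-- The right action of `M(X,S)` on `ℕ^X` by affine transformations. -/
noncomputable def affineAction : sol.M →* (Function.End (X →₀ ℕ))ᵐᵒᵖ :=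
  PresentedMonoid.lift (fun x => MulOpposite.op (sol.affineStep x)) sol.affineStep_rel

/-- The cocycle `c : M(X,S) → ℕ^X` with `c_x = x` for `x` in `X`: the translation part of the
affine action. -/
noncomputable def cocycle (a : sol.M) : X →₀ ℕ := (sol.affineAction a).unop 0

theorem affineAction_mul_gen (a : sol.M) (x : X) (u : X →₀ ℕ) :
    (sol.affineAction (a * sol.gen x)).unop u =
      Finsupp.single x 1 + ((sol.affineAction a).unop u).mapDomain (sol.phiGen x).symm := by
  rw [map_mul, MulOpposite.unop_mul]
  rfl

theorem affineAction_apply (a : sol.M) (u : X →₀ ℕ) :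
    (sol.affineAction a).unop u = sol.cocycle a + u.mapDomain (sol.phiM a).symm := by
  induction a using sol.mul_gen_induction with
  | one =>
    have hid : u.mapDomain (sol.phiM 1).symm = u := by
      rw [phiM_one]
      exact Finsupp.mapDomain_id
    simp [cocycle, hid, Function.End.one_def]
  | mul_gen a x ih =>
    rw [cocycle, affineAction_mul_gen, affineAction_mul_gen, ih, ← cocycle, Finsupp.mapDomain_add,
      ← Finsupp.mapDomain_comp, add_assoc, phiM_mul, phiM_gen]
    rfl

theorem cocycle_one : sol.cocycle 1 = 0 := by
  simp [cocycle, Function.End.one_def]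

theorem cocycle_mul (a d : sol.M) :
    sol.cocycle (a * d) = sol.cocycle d + (sol.cocycle a).mapDomain (sol.phiM d).symm := by
  rw [← affineAction_apply, cocycle, map_mul, MulOpposite.unop_mul]
  rfl

theorem cocycle_mul_apply (a d : sol.M) (z : X) :
    sol.cocycle (a * d) z = sol.cocycle d z + sol.cocycle a (sol.phiM d z) := by
  rw [cocycle_mul, Finsupp.add_apply, Finsupp.mapDomain_equiv_apply, Equiv.symm_symm]

theorem cocycle_gen (x : X) : sol.cocycle (sol.gen x) = Finsupp.single x 1 := by
  rw [← one_mul (sol.gen x), cocycle, affineAction_mul_gen, ← cocycle, cocycle_one,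
    Finsupp.mapDomain_zero, add_zero]

theorem len_eq_degree_cocycle (a : sol.M) : sol.len a = (sol.cocycle a).degree := by
  induction a using sol.mul_gen_induction with
  | one => simp [len_one, cocycle_one]
  | mul_gen a x ih =>
    rw [len_mul, len_gen, cocycle_mul, cocycle_gen, map_add, Finsupp.degree_single,
      Finsupp.degree_mapDomain, ih, add_comm]

theorem cocycle_gen_mul (a : sol.M) (x : X) :
    sol.cocycle (sol.gen (sol.phiM a x) * a) = sol.cocycle a + Finsupp.single x 1 := by
  rw [cocycle_mul, cocycle_gen, Finsupp.mapDomain_single, Equiv.symm_apply_apply]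

theorem cocycle_surjective : Function.Surjective sol.cocycle := by
  classical
  intro u
  obtain ⟨s, rfl⟩ := Multiset.toFinsupp.surjective u
  induction s using Multiset.induction with
  | empty => exact ⟨1, by rw [cocycle_one, map_zero]⟩
  | cons x s ih =>
    obtain ⟨a, ha⟩ := ih
    refine ⟨sol.gen (sol.phiM a x) * a, ?_⟩
    rw [cocycle_gen_mul, ha, ← Multiset.singleton_add, map_add, Multiset.toFinsupp_singleton,
      add_comm]

theorem cocycle_mul_le_cocycle_mul_iff {a a' d : sol.M} :
    sol.cocycle (a * d) ≤ sol.cocycle (a' * d) ↔ sol.cocycle a ≤ sol.cocycle a' := by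
  simp only [Finsupp.le_def, cocycle_mul_apply, add_le_add_iff_left]
  exact (sol.phiM d).forall_congr_right (q := fun z => sol.cocycle a z ≤ sol.cocycle a' z)

theorem rightDivides_gen_iff {a : sol.M} {x : X} :
    RightDivides (sol.gen x) a ↔ 0 < sol.cocycle a x := by
  constructor
  · rintro ⟨d, rfl⟩
    simp [cocycle_mul_apply, cocycle_gen]
  intro hx
  induction a using sol.mul_gen_induction generalizing x with
  | one => simp [cocycle_one] at hx
  | mul_gen a y ih =>
    obtain rfl | hxy := eq_or_ne x y
    · exact ⟨a, rfl⟩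
    rw [cocycle_mul_apply, cocycle_gen, Finsupp.single_eq_of_ne hxy, zero_add, phiM_gen] at hx
    obtain ⟨d, rfl⟩ := ih hx
    exact ⟨d * sol.gen (sol.phiGen x y), by rw [mul_assoc, mul_assoc, gen_phiGen_mul_gen]⟩

theorem rightDivides_iff {a d : sol.M} : RightDivides d a ↔ sol.cocycle d ≤ sol.cocycle a := by
  constructor
  · rintro ⟨c, rfl⟩
    exact sol.cocycle_mul c d ▸ le_self_add
  intro hle
  induction d using sol.mul_gen_induction generalizing a with
  | one => exact ⟨a, (mul_one a).symm⟩
  | mul_gen d x ih =>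
    have hx : 0 < sol.cocycle a x :=
      (sol.rightDivides_gen_iff.1 ⟨d, rfl⟩).trans_le (hle x)
    obtain ⟨a, rfl⟩ := sol.rightDivides_gen_iff.2 hx
    obtain ⟨c, rfl⟩ := ih (sol.cocycle_mul_le_cocycle_mul_iff.1 hle)
    exact ⟨c, mul_assoc c d _⟩

theorem cocycle_injective : Function.Injective sol.cocycle := fun a d h =>
  eq_of_rightDivides_of_len_le (sol.rightDivides_iff.2 h.le)
    (by simp only [len_eq_degree_cocycle, h, le_refl])

theorem finite_rightDivides (d : sol.M) : {a | RightDivides a d}.Finite := by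
  classical
  simp only [rightDivides_iff]
  exact (Set.finite_Iic (sol.cocycle d)).preimage sol.cocycle_injective.injOn

instance : IsLeftCancelMul sol.M where
  mul_left_cancel a d d' h := by
    have hphi : sol.phiM d = sol.phiM d' := by
      simpa only [phiM_mul, mul_right_inj] using congrArg sol.phiM h
    apply sol.cocycle_injective
    simpa only [cocycle_mul, hphi, add_left_inj] using congrArg sol.cocycle h

/-! ### Simple elements and the Garside element -/

/-- An element `a` of `M(X,S)` is simple when its cocycle takes only the values `0` and `1`. For
finite `X`, these are the divisors of the Garside element, and the definition by the cocycle makes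
sense for all `X`. -/
def IsSimple (a : sol.M) : Prop := ∀ x, sol.cocycle a x ≤ 1

section Simple

variable {sol} {a d s : sol.M}

theorem IsSimple.of_leftDivides (hs : sol.IsSimple s) (h : LeftDivides a s) : sol.IsSimple a := by
  obtain ⟨d, rfl⟩ := h
  intro z
  have hz := hs ((sol.phiM d).symm z)
  rw [cocycle_mul_apply, Equiv.apply_symm_apply] at hz
  exact le_of_add_le_right hz

theorem IsSimple.of_rightDivides (hs : sol.IsSimple s) (h : RightDivides d s) : sol.IsSimple d :=
  fun x => (sol.rightDivides_iff.1 h x).trans (hs x)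

end Simple

section Garside

variable [Finite X]

/-- The Garside element `Δ` of `M(X,S)`, whose cocycle is constant with value `1`. -/
noncomputable def delta : sol.M :=
  Function.surjInv sol.cocycle_surjective (Finsupp.equivFunOnFinite.symm 1)

theorem cocycle_delta (x : X) : sol.cocycle sol.delta x = 1 := by
  rw [delta, Function.surjInv_eq sol.cocycle_surjective,
    Finsupp.equivFunOnFinite_symm_apply_apply, Pi.one_apply]

theorem rightDivides_delta_iff {a : sol.M} : RightDivides a sol.delta ↔ sol.IsSimple a := by
  simp only [rightDivides_iff, Finsupp.le_def, cocycle_delta, IsSimple]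

theorem isSimple_delta : sol.IsSimple sol.delta := fun x => (sol.cocycle_delta x).le

theorem isBalanced_delta : IsBalanced sol.delta :=
  .of_finite_rightDivides (sol.finite_rightDivides _) fun _ ha =>
    sol.rightDivides_delta_iff.2 (sol.isSimple_delta.of_leftDivides ha)

theorem isGarsideElement_delta : IsGarsideElement sol.delta := by
  refine ⟨sol.isBalanced_delta, ?_⟩
  rw [← top_le_iff, ← PresentedMonoid.closure_range_of sol.monoidRels]
  refine Submonoid.closure_mono (Set.range_subset_iff.2 fun x => ?_)
  refine (sol.isBalanced_delta _).2 (sol.rightDivides_gen_iff.2 ?_)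
  rw [cocycle_delta]
  exact Nat.one_pos

variable {sol}

theorem rightDivides_delta_of_isGarsideElement {e : sol.M} (he : IsGarsideElement e) :
    RightDivides sol.delta e := by
  refine sol.rightDivides_iff.2 fun x => ?_
  have hx : sol.gen x ∈ divisorSet e :=
    sol.mem_of_mem_closure_of_len_eq_one (he.2.symm ▸ Submonoid.mem_top _) (sol.len_gen x)
  rw [cocycle_delta]
  exact sol.rightDivides_gen_iff.1 ((he.1 _).1 hx)

theorem isMinGarsideElement_iff_eq_delta {e : sol.M} :
    IsMinGarsideElement e ↔ e = sol.delta := by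
  constructor
  · intro he
    exact eq_of_rightDivides_of_len_le (he.2 _ sol.isGarsideElement_delta).2
      (len_le_of_rightDivides (rightDivides_delta_of_isGarsideElement he.1))
  · rintro rfl
    refine ⟨sol.isGarsideElement_delta, fun e he => ?_⟩
    have hright := rightDivides_delta_of_isGarsideElement he
    exact ⟨(he.1 _).2 hright, hright⟩

end Garside

/-! ### The representation -/

section Signs

variable {V : Type*} [AddCommGroup V] [Module ℝ V] (b : Module.Basis X ℝ V)

theorem psiM_one : sol.psiM b 1 = 1 := by simp [psiM]

theorem psiM_mul (a d : sol.M) : sol.psiM b (a * d) = sol.psiM b a * sol.psiM b d := by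
  simp [psiM]

theorem coe_psiM_gen (x : X) : (sol.psiM b (sol.gen x) : V ≃ₗ[ℝ] V) = sol.psiGen b x :=
  PresentedGroup.toGroup.of (sol.psi_aux b)

theorem psiGen_apply (x y : X) :
    sol.psiGen b x (b y) = (-1 : ℝ) ^ Finsupp.single x 1 y • b (sol.phiGen x y) := by
  obtain rfl | hxy := eq_or_ne y x
  · rw [psiGen_self, Finsupp.single_eq_same, pow_one, neg_one_smul]
  · rw [sol.psiGen_of_ne b hxy, Finsupp.single_eq_of_ne hxy, pow_zero, one_smul]

theorem psiM_apply (a : sol.M) (y : X) :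
    (sol.psiM b a : V ≃ₗ[ℝ] V) (b y) = (-1 : ℝ) ^ sol.cocycle a y • b (sol.phiM a y) := by
  induction a using sol.mul_gen_induction generalizing y with
  | one => simp [psiM_one, cocycle_one, phiM_one]
  | mul_gen a x ih =>
    rw [psiM_mul, Subgroup.coe_mul, LinearEquiv.mul_apply, coe_psiM_gen, psiGen_apply, map_smul,
      ih, smul_smul, cocycle_mul_apply, cocycle_gen, pow_add, phiM_mul, phiM_gen,
      Equiv.Perm.mul_apply]

theorem psiM_apply_of_not_rightDivides {a : sol.M} {x : X} (hx : ¬RightDivides (sol.gen x) a) :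
    (sol.psiM b a : V ≃ₗ[ℝ] V) (b x) = b (sol.phiM a x) := by
  rw [rightDivides_gen_iff, Nat.pos_iff_ne_zero, not_not] at hx
  rw [psiM_apply, hx, pow_zero, one_smul]

theorem psiM_apply_mem_range_iff (a : sol.M) (x : X) :
    (sol.psiM b a : V ≃ₗ[ℝ] V) (b x) ∈ Set.range b ↔ Even (sol.cocycle a x) := by
  rw [psiM_apply]
  rcases Nat.even_or_odd (sol.cocycle a x) with heven | hodd
  · simp [heven.neg_one_pow, heven]
  · rw [hodd.neg_one_pow, neg_one_smul]
    refine iff_of_false ?_ (Nat.not_even_iff_odd.2 hodd)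
    rintro ⟨y, hy⟩
    exact basis_ne_neg_basis b _ _ hy

theorem signCount_psiM (a : sol.M) :
    signCount b (sol.psiM b a) = Set.ncard {x | Odd (sol.cocycle a x)} := by
  simp only [signCount, psiM_apply_mem_range_iff, Nat.not_even_iff_odd]

theorem psiM_surjective [Finite X] : Function.Surjective (sol.psiM b) := by
  let psiHom : sol.M →* sol.W b := (sol.psi b).rangeRestrict.comp sol.toG
  have hgen : sol.genSet b ⊆ MonoidHom.mrange psiHom := by
    rintro _ ⟨x, rfl⟩
    exact ⟨sol.gen x, rfl⟩
  exact MonoidHom.mrange_eq_top.1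
    (top_le_iff.1 (sol.closure_genSet b ▸ Submonoid.closure_le.2 hgen))

theorem psiM_mk (w : FreeMonoid X) :
    sol.psiM b (PresentedMonoid.mk sol.monoidRels w) =
      (w.toList.map fun x => sol.psiM b (sol.gen x)).prod := by
  induction w with
  | one => simp [psiM_one]
  | of x => simp [gen, PresentedMonoid.of]
  | mul v w hv hw => simp [psiM_mul, hv, hw]

theorem wordLength_genSet_eq_sInf (w : sol.W b) :
    wordLength (sol.genSet b) w = sInf (sol.len '' {a | sol.psiM b a = w}) := by
  refine congrArg sInf (Set.ext fun k => ⟨?_, ?_⟩)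
  · rintro ⟨l, hl, rfl, rfl⟩
    obtain ⟨l, rfl⟩ : l ∈ Set.range (List.map fun x => sol.psiM b (sol.gen x)) := by
      rwa [Set.range_list_map]
    refine ⟨PresentedMonoid.mk _ (FreeMonoid.ofList l), sol.psiM_mk b _, ?_⟩
    rw [len_mk, FreeMonoid.toList_ofList, List.length_map]
  · rintro ⟨a, rfl, rfl⟩
    obtain ⟨v, rfl⟩ := PresentedMonoid.surjective_mk a
    refine ⟨v.toList.map fun x => sol.psiM b (sol.gen x), ?_, (sol.psiM_mk b v).symm, ?_⟩
    · exact List.forall_mem_map.2 fun x _ => ⟨x, rfl⟩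
    · rw [len_mk, List.length_map]

theorem exists_psiM_eq_and_len_eq_wordLength [Finite X] (w : sol.W b) :
    ∃ a, sol.psiM b a = w ∧ sol.len a = wordLength (sol.genSet b) w := by
  rw [wordLength_genSet_eq_sInf]
  exact Nat.sInf_mem (Set.Nonempty.image _ (sol.psiM_surjective b w))

namespace IsSimple

variable {sol} {s a : sol.M}

theorem rightDivides_of_psiM_eq (hs : sol.IsSimple s) (h : sol.psiM b a = sol.psiM b s) :
    RightDivides s a := by
  refine sol.rightDivides_iff.2 fun x => ?_
  have hparity : Even (sol.cocycle a x) ↔ Even (sol.cocycle s x) := by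
    rw [← sol.psiM_apply_mem_range_iff b, h, psiM_apply_mem_range_iff]
  have hsx := hs x
  rw [Nat.even_iff, Nat.even_iff] at hparity
  omega

theorem wordLength_psiM (hs : sol.IsSimple s) :
    wordLength (sol.genSet b) (sol.psiM b s) = sol.len s := by
  rw [wordLength_genSet_eq_sInf]
  refine IsLeast.csInf_eq ⟨⟨s, rfl, rfl⟩, ?_⟩
  rintro _ ⟨a, ha, rfl⟩
  exact len_le_of_rightDivides (hs.rightDivides_of_psiM_eq b ha)

theorem signCount_psiM (hs : sol.IsSimple s) : signCount b (sol.psiM b s) = sol.len s := by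
  have hsupp : {x | Odd (sol.cocycle s x)} = (sol.cocycle s).support := by
    ext x
    have hsx := hs x
    simp only [Set.mem_ofPred_eq, Finset.mem_coe, Finsupp.mem_support_iff, Nat.odd_iff]
    omega
  rw [YBSolution.signCount_psiM, hsupp, Set.ncard_coe_finset, len_eq_degree_cocycle,
    Finsupp.degree_apply, Finset.card_eq_sum_ones]
  exact Finset.sum_congr rfl fun x hx =>
    le_antisymm (Nat.pos_of_ne_zero (Finsupp.mem_support_iff.1 hx)) (hs x)

theorem psiM_apply_of_rightDivides (hs : sol.IsSimple s) {x : X}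
    (hx : RightDivides (sol.gen x) s) :
    (sol.psiM b s : V ≃ₗ[ℝ] V) (b x) = -b (sol.phiM s x) := by
  have hone : sol.cocycle s x = 1 := le_antisymm (hs x) (sol.rightDivides_gen_iff.1 hx)
  rw [psiM_apply, hone, pow_one, neg_one_smul]

theorem psiM_injOn : Set.InjOn (sol.psiM b) {s | sol.IsSimple s} := fun _ hs _ ha h =>
  eq_of_rightDivides_of_len_le (hs.rightDivides_of_psiM_eq b h.symm)
    (len_le_of_rightDivides (ha.rightDivides_of_psiM_eq b h))

theorem psiM_eq_mul_iff [Finite X] (hs : sol.IsSimple s) {v u : sol.W b} :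
    (sol.psiM b s = v * u ∧ wordLength (sol.genSet b) (sol.psiM b s) =
        wordLength (sol.genSet b) v + wordLength (sol.genSet b) u) ↔
      ∃ a d, s = a * d ∧ sol.psiM b a = v ∧ sol.psiM b d = u := by
  constructor
  · rintro ⟨hmul, hlen⟩
    obtain ⟨a, rfl, ha⟩ := sol.exists_psiM_eq_and_len_eq_wordLength b v
    obtain ⟨d, rfl, hd⟩ := sol.exists_psiM_eq_and_len_eq_wordLength b u
    have hdiv : RightDivides s (a * d) :=
      hs.rightDivides_of_psiM_eq b (by rw [psiM_mul, hmul])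
    rw [hs.wordLength_psiM, ← ha, ← hd, ← len_mul] at hlen
    exact ⟨a, d, eq_of_rightDivides_of_len_le hdiv hlen.ge, rfl, rfl⟩
  · rintro ⟨a, d, rfl, rfl, rfl⟩
    rw [hs.wordLength_psiM, (hs.of_leftDivides ⟨d, rfl⟩).wordLength_psiM,
      (hs.of_rightDivides ⟨a, rfl⟩).wordLength_psiM]
    exact ⟨sol.psiM_mul b a d, sol.len_mul a d⟩

theorem leftFactors_psiM [Finite X] (hs : sol.IsSimple s) :
    leftFactors (sol.genSet b) (sol.psiM b s) = sol.psiM b '' divisorSet s := by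
  ext v
  refine (exists_congr fun u => hs.psiM_eq_mul_iff b).trans ⟨?_, ?_⟩
  · rintro ⟨_, a, d, hprod, rfl, rfl⟩
    exact ⟨a, ⟨d, hprod⟩, rfl⟩
  · rintro ⟨a, ⟨d, hprod⟩, rfl⟩
    exact ⟨_, a, d, hprod, rfl, rfl⟩

theorem rightFactors_psiM [Finite X] (hs : sol.IsSimple s) :
    rightFactors (sol.genSet b) (sol.psiM b s) = sol.psiM b '' {d | RightDivides d s} := by
  ext v
  refine (exists_congr fun u => hs.psiM_eq_mul_iff b).trans ⟨?_, ?_⟩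
  · rintro ⟨_, a, d, hprod, rfl, rfl⟩
    exact ⟨d, ⟨a, hprod⟩, rfl⟩
  · rintro ⟨d, ⟨a, hprod⟩, rfl⟩
    exact ⟨_, a, d, hprod, rfl, rfl⟩

theorem isFactorBalanced_psiM [Finite X] (hs : sol.IsSimple s) (hbal : IsBalanced s) :
    IsFactorBalanced (sol.genSet b) (sol.psiM b s) := by
  rw [IsFactorBalanced, hs.leftFactors_psiM, hs.rightFactors_psiM]
  exact congrArg _ (Set.ext hbal)

end IsSimple

end Signs

end YBSolution

theorem mainTheorem6 {X : Type*} [Finite X] (sol : YBSolution X)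
    {V : Type*} [AddCommGroup V] [Module ℝ V] (b : Module.Basis X ℝ V) :
    (∃! Δ : sol.M, IsMinGarsideElement Δ) ∧
    ∀ Δ : sol.M, IsMinGarsideElement Δ →
      (∀ a ∈ divisorSet Δ,
        (sol.len a = wordLength (sol.genSet b) (sol.psiM b a) ∧
          wordLength (sol.genSet b) (sol.psiM b a) = signCount b (sol.psiM b a)) ∧
        ∀ x : X,
          (RightDivides (sol.gen x) a →
            (sol.psiM b a : V ≃ₗ[ℝ] V) (b x) = -b (sol.phiM a x)) ∧
          (¬ RightDivides (sol.gen x) a →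
            (sol.psiM b a : V ≃ₗ[ℝ] V) (b x) = b (sol.phiM a x))) ∧
      Set.InjOn (sol.psiM b) (divisorSet Δ) ∧
      (IsFactorBalanced (sol.genSet b) (sol.psiM b Δ) ∧
        leftFactors (sol.genSet b) (sol.psiM b Δ) = sol.psiM b '' divisorSet Δ) := by
  simp only [YBSolution.isMinGarsideElement_iff_eq_delta, existsUnique_eq, forall_eq, true_and]
  have hΔ := sol.isSimple_delta
  have hsimple : ∀ a ∈ divisorSet sol.delta, sol.IsSimple a := fun _ => hΔ.of_leftDivides
  refine ⟨fun a ha => ?_, (YBSolution.IsSimple.psiM_injOn b).mono hsimple,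
    hΔ.isFactorBalanced_psiM b sol.isBalanced_delta, hΔ.leftFactors_psiM b⟩
  have hlen := (hsimple a ha).wordLength_psiM b
  have hcount := (hsimple a ha).signCount_psiM b
  exact ⟨⟨hlen.symm, hlen.trans hcount.symm⟩, fun x =>
    ⟨(hsimple a ha).psiM_apply_of_rightDivides b, sol.psiM_apply_of_not_rightDivides b⟩⟩
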